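/- Let $N\ge 1$ and let $\mathbf U$ be a uniformly random unitary matrix in $\mathbb C^{N^2\times N^2}$, that is, a random element of the unitary group $\mathcal U(N^2)$ whose law is the Haar probability measure. Divide $\mathbf U$ into $N\times N$ consecutive blocks, each of size $N\times N$, and for $k,l\in\{1,\dots,N\}$ let $\mathbf U_{kl}\in\mathbb C^{N\times N}$ be the $(k,l)$-th block, with entries $(\mathbf U_{kl})_{ij}=\mathbf U_{(k-1)N+i,\,(l-1)N+j}$ for $1\le i,j\le N$. Then for all $k,l=1,\dots,N$, the block $\mathbf U_{kl}$ is invertible with probability $1$. -/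

import Mathlib

open MeasureTheory ProbabilityTheory

/-- The row (or column) index of an `N² × N²` matrix, cut into consecutive groups of length `N`,
that is the `i`-th index of the `k`-th group: `k * N + i` when counting from `0`. -/
def blockIndex {N : ℕ} (k i : Fin N) : Fin (N ^ 2) :=
  ⟨k.val * N + i.val, by
    have h : (k.val + 1) * N ≤ N * N := Nat.mul_le_mul_right N k.isLt
    have hi : i.val < N := i.isLt
    nlinarith⟩

/-- The `(k, l)`-th `N × N` block of an `N² × N²` matrix. -/
def subblock {N : ℕ} (A : Matrix (Fin (N ^ 2)) (Fin (N ^ 2)) ℂ) (k l : Fin N) :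
    Matrix (Fin N) (Fin N) ℂ :=
  A.submatrix (blockIndex k) (blockIndex l)

/-! A block's determinant is real analytic along each orbit `t ↦ exp(ita) v`. Since every unitary is
an exponential, some orbit joins a given `u` to a permutation matrix whose block is the identity.
Near `u`, orbits of the same subgroup thus vanish only at a null set of times; Fubini and left
invariance turn this into Haar-nullity. -/

/-- The zero set of a continuous function on a topological group is null for every finite
left-invariant measure, if each point can be moved out of it along a one-parameter subgroup along
all of whose orbits the function is real analytic. -/
theorem ae_ne_zero_of_analytic_along_oneParam {G : Type*} [Group G] [TopologicalSpace G]
    [IsTopologicalGroup G] [SecondCountableTopology G] [MeasurableSpace G] [BorelSpace G]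
    (μ : Measure G) [IsFiniteMeasure μ] [μ.IsMulLeftInvariant] (f : G → ℂ) (hf : Continuous f)
    (h : ∀ u, ∃ γ : ℝ → G, Continuous γ ∧ (∀ s t, γ (s + t) = γ s * γ t) ∧
      (∀ v, AnalyticOnNhd ℝ (fun t ↦ f (γ t * v)) Set.univ) ∧ ∃ t, f (γ t * u) ≠ 0) :
    ∀ᵐ u ∂μ, f u ≠ 0 := by
  have hZ : IsClosed {u | f u = 0} := isClosed_singleton.preimage hf
  suffices μ {u | f u = 0} = 0 by simpa [ae_iff] using this
  refine measure_null_of_locally_null _ fun u _ ↦ ?_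
  obtain ⟨γ, hγ, hadd, han, t₀, ht₀⟩ := h u
  let O : Set G := {v | f (γ t₀ * v) ≠ 0}
  have hO : IsOpen O := isOpen_ne_fun (by fun_prop) continuous_const
  refine ⟨{u | f u = 0} ∩ O, inter_mem_nhdsWithin _ (hO.mem_nhds ht₀), ?_⟩
  set S : Set G := {u | f u = 0} ∩ O
  have hSm : MeasurableSet S := hZ.measurableSet.inter hO.measurableSet
  have hE : MeasurableSet {p : G × ℝ | γ p.2 * p.1 ∈ S} :=
    (show Continuous fun p : G × ℝ ↦ γ p.2 * p.1 by fun_prop).measurable hSm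
  -- An orbit meeting `O` carries a nonzero analytic function, whose zeros are discrete; any other
  -- orbit misses `S`.
  have key : ∀ v, ∀ᵐ t : ℝ, γ t * v ∉ S := by
    intro v
    by_cases hv : ∃ s, γ s * v ∈ O
    · obtain ⟨s, hs⟩ := hv
      have hne : f (γ (t₀ + s) * v) ≠ 0 := by
        rw [hadd, mul_assoc]; exact hs
      rcases (han v).eqOn_zero_or_eventually_ne_zero_of_preconnected isPreconnected_univ with h0 | h0
      · exact absurd (h0 (Set.mem_univ (t₀ + s))) hne
      · have := ae_restrict_le_codiscreteWithin (μ := volume) MeasurableSet.univ h0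
        rw [Measure.restrict_univ] at this
        filter_upwards [this] with t ht hmem
        exact ht hmem.1
    · exact .of_forall fun t ht ↦ hv ⟨t, ht.2⟩
  -- By Fubini some single translate of `S` is null, hence so is `S`.
  have h1 : ∀ᵐ t : ℝ, ∀ᵐ v ∂μ, γ t * v ∉ S :=
    (Measure.ae_ae_comm hE.compl).1 (.of_forall key)
  obtain ⟨t, ht⟩ := h1.exists
  rw [← measure_preimage_mul μ (γ t) S]
  simpa only [not_not] using! ae_iff.1 ht

namespace Matrix

open scoped Matrix.Norms.L2Operator

/-- Every unitary matrix is the exponential of `i` times a self-adjoint matrix. -/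
theorem exists_expUnitary_eq {n : Type*} [Fintype n] [DecidableEq n] (u : unitaryGroup n ℂ) :
    ∃ a : selfAdjoint (Matrix n n ℂ), selfAdjoint.expUnitary a = u := by
  -- On a finite spectrum the branch cut of `arg` does no harm to continuity.
  have hfin : Finite (spectrum ℂ (u : Matrix n n ℂ)) := finite_spectrum _
  have hcont : ∀ g : ℂ → ℂ, ContinuousOn g (spectrum ℂ (u : Matrix n n ℂ)) := fun g ↦
    (Set.toFinite _).continuousOn g
  have := hcont fun z ↦ (z.arg : ℂ)
  refine ⟨⟨cfc (fun z : ℂ ↦ (z.arg : ℂ)) (u : Matrix n n ℂ), IsSelfAdjoint.cfc_arg (u : Matrix n n ℂ)⟩, ?_⟩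
  apply Subtype.ext
  rw [selfAdjoint.expUnitary_coe, ← CFC.exp_eq_normedSpace_exp (𝕜 := ℂ), ← cfc_comp_smul ..,
    ← cfc_comp' ..]
  conv_rhs => rw [← cfc_id' ℂ (u : Matrix n n ℂ)]
  refine cfc_congr fun y hy ↦ ?_
  have hy₁ : ‖y‖ = 1 := spectrum.norm_eq_one_of_unitary u.2 hy
  have h : Complex.I * y.arg = Complex.log y :=
    Complex.ext (by simp [Complex.log_re, hy₁]) (by simp [Complex.log_im])
  have hy0 : y ≠ 0 := by rintro rfl; simp at hy₁
  simpa [← Complex.exp_eq_exp_ℂ, h] using Complex.exp_log hy0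

/-- Minors are real analytic along the orbits of the one-parameter subgroups of the unitary
group. -/
theorem analyticOnNhd_det_submatrix_expUnitary_mul {n m : Type*} [Fintype n] [DecidableEq n]
    [Fintype m] [DecidableEq m] (r c : m → n) (a : selfAdjoint (Matrix n n ℂ))
    (v : Matrix n n ℂ) :
    AnalyticOnNhd ℝ (fun t : ℝ ↦
      (((selfAdjoint.expUnitary (t • a) : Matrix n n ℂ) * v).submatrix r c).det) Set.univ := by
  intro t _
  have hexp : AnalyticAt ℝ (fun t : ℝ ↦ (selfAdjoint.expUnitary (t • a) : Matrix n n ℂ)) t := by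
    simp only [selfAdjoint.expUnitary_coe, selfAdjoint.val_smul]
    refine (NormedSpace.exp_analytic (𝕂 := ℝ) _).comp ?_
    have : (fun t : ℝ ↦ Complex.I • t • (a : Matrix n n ℂ)) =
        fun t : ℝ ↦ t • (Complex.I • (a : Matrix n n ℂ)) := by
      ext1 t; exact smul_comm _ _ _
    rw [this]
    fun_prop
  have hentry : ∀ i j, AnalyticAt ℝ (fun t : ℝ ↦
      ((selfAdjoint.expUnitary (t • a) : Matrix n n ℂ) * v) i j) t := fun i j ↦
    ((entryLinearMap ℝ ℂ i j ∘ₗ LinearMap.mulRight ℝ v).toContinuousLinearMap.analyticAt _).comp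
      hexp
  simp only [det_apply, submatrix_apply, Units.smul_def, zsmul_eq_mul]
  exact Finset.analyticAt_fun_sum _ fun σ _ ↦ analyticAt_const.mul <|
    Finset.analyticAt_fun_prod _ fun i _ ↦ hentry _ _

/-- A permutation matrix with a prescribed submatrix equal to the identity. -/
theorem exists_unitary_submatrix_eq_one {n m : Type*} [Fintype n] [DecidableEq n]
    [Fintype m] [DecidableEq m] {r c : m → n} (hr : Function.Injective r)
    (hc : Function.Injective c) :
    ∃ u : unitaryGroup n ℂ, (u : Matrix n n ℂ).submatrix r c = 1 := by
  obtain ⟨σ, hσ⟩ := Equiv.Perm.exists_extending_pair r c hr hc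
  refine ⟨⟨σ.permMatrix ℂ, ?_⟩, ?_⟩
  · rw [mem_unitaryGroup_iff, star_eq_conjTranspose, conjTranspose_permMatrix, ← permMatrix_mul]
    simp
  · ext i j
    simp [Equiv.Perm.permMatrix, PEquiv.toMatrix_apply, one_apply, hσ, hc.eq_iff]

/-- Every square submatrix of a Haar distributed unitary matrix is almost surely invertible. -/
theorem ae_isUnit_submatrix_unitaryGroup {n m : Type*} [Fintype n] [DecidableEq n]
    [Fintype m] [DecidableEq m] {r c : m → n} (hr : Function.Injective r)
    (hc : Function.Injective c) [MeasurableSpace (unitaryGroup n ℂ)]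
    [BorelSpace (unitaryGroup n ℂ)] (μ : Measure (unitaryGroup n ℂ)) [IsFiniteMeasure μ]
    [μ.IsMulLeftInvariant] :
    ∀ᵐ u : unitaryGroup n ℂ ∂μ, IsUnit ((u : Matrix n n ℂ).submatrix r c) := by
  have : SecondCountableTopology (Matrix n n ℂ) :=
    inferInstanceAs (SecondCountableTopology (n → n → ℂ))
  have : SecondCountableTopology (unitaryGroup n ℂ) :=
    TopologicalSpace.Subtype.secondCountableTopology _
  simp only [isUnit_iff_isUnit_det, isUnit_iff_ne_zero]
  refine ae_ne_zero_of_analytic_along_oneParam μ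
    (fun u : unitaryGroup n ℂ ↦ ((u : Matrix n n ℂ).submatrix r c).det)
    (continuous_subtype_val.matrix_submatrix r c).matrix_det fun u ↦ ?_
  obtain ⟨w, hw⟩ := exists_unitary_submatrix_eq_one hr hc
  obtain ⟨a, ha⟩ := exists_expUnitary_eq (w * u⁻¹)
  -- At time `1` the orbit of `u` reaches `w * u⁻¹ * u = w`, whose minor is `1`.
  refine ⟨fun t ↦ selfAdjoint.expUnitary (t • a), by fun_prop, fun s t ↦ ?_, fun v ↦ ?_, 1, ?_⟩
  · simp only [add_smul]
    exact Commute.expUnitary_add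
      (((Commute.refl (a : Matrix n n ℂ)).smul_left s).smul_right t)
  · exact analyticOnNhd_det_submatrix_expUnitary_mul r c a v
  · simp only [one_smul, ha, inv_mul_cancel_right, hw, det_one]
    exact one_ne_zero

end Matrix

theorem blockIndex_injective {N : ℕ} (k : Fin N) : Function.Injective (blockIndex k) := by
  intro i j h
  simpa [blockIndex, Fin.ext_iff] using h

theorem mainTheorem7 (N : ℕ)
    [MeasurableSpace (Matrix.unitaryGroup (Fin (N ^ 2)) ℂ)]
    [BorelSpace (Matrix.unitaryGroup (Fin (N ^ 2)) ℂ)]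
    (μ : Measure (Matrix.unitaryGroup (Fin (N ^ 2)) ℂ))
    [μ.IsHaarMeasure] [IsProbabilityMeasure μ]
    {Ω : Type*} [MeasurableSpace Ω] (P : Measure Ω) [IsProbabilityMeasure P]
    (U : Ω → Matrix.unitaryGroup (Fin (N ^ 2)) ℂ) (hU : HasLaw U μ P)
    (k l : Fin N) :
    ∀ᵐ ω ∂P, IsUnit (subblock (U ω : Matrix (Fin (N ^ 2)) (Fin (N ^ 2)) ℂ) k l) := by
  have hμ := Matrix.ae_isUnit_submatrix_unitaryGroup (blockIndex_injective k)
    (blockIndex_injective l) μ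
  rw [← hU.map_eq] at hμ
  exact ae_of_ae_map hU.aemeasurable hμ
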